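/- A finitely generated group is \emph{one-ended} if its Cayley graph with respect to a finite generating set has exactly one end. For a family $\mathcal{D}$ of groups that is closed under taking finite-index subgroups, a \emph{multiplicative invariant} on $\mathcal{D}$ is an isomorphism-invariant function $\sigma:\mathcal{D}\to\mathbb{R}$ such that $\sigma(H)=[G:H]\,\sigma(G)$ whenever $G\in\mathcal{D}$ and $H\le G$ is a subgroup of finite index. Let $\mathcal{C}$ be a family of one-ended groups that is closed under taking finite-index subgroups, and let $\rho$ be a multiplicative invariant on $\mathcal{C}$. Let $\mathcal{C}'$ be the family of all groups isomorphic to a free product $G_1*\cdots*G_n*F_r$ with $n,r\ge 0$ and $G_1,\dots,G_n\in\mathcal{C}$, where $F_r$ is the free group of rank $r$. Then: \begin{enumerate} \item the formula \[\chi_\rho(G_1*\cdots*G_n*F_r)=1-r-n+\sum_{i=1}^n\rho(G_i)\] gives a well-defined function $\chi_\rho:\mathcal{C}'\to\mathbb{R}$, that is, its value on a group in $\mathcal{C}'$ does not depend on the chosen decomposition; \item $\mathcal{C}'$ is closed under taking finite-index subgroups; \item $\chi_\rho$ is a multiplicative invariant on $\mathcal{C}'$: it is isomorphism-invariant, and $\chi_\rho(H)=[G:H]\,\chi_\rho(G)$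 for every $G\in\mathcal{C}'$ and every finite-index subgroup $H\le G$. \end{enumerate} -/

import Mathlib

universe u

/-- The space of ends of the Cayley graph of `G` with respect to the generating set `S`. -/
def CayleyEnds (G : Type u) [Group G] (S : Set G) : Type u :=
  ↥(SimpleGraph.mulCayley S).end

/-- A group is one-ended if it is generated by a finite set with respect to which its Cayley graph
has exactly one end. (The number of ends does not depend on the finite generating set.) -/
def IsOneEnded (G : Type u) [Group G] : Prop :=
  ∃ S : Set G, S.Finite ∧ Subgroup.closure S = ⊤ ∧ Nat.card (CayleyEnds G S) = 1

/-- A family of groups, given by its membership predicate. -/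
abbrev GroupFamily : Type (u + 1) :=
  ∀ (G : Type u) [Group G], Prop

/-- A real-valued function on (the members of) a family of groups. -/
abbrev GroupFamily.RealFunction (C : GroupFamily.{u}) : Type (u + 1) :=
  ∀ (G : Type u) [Group G], C G → ℝ

/-- The family is closed under taking finite-index subgroups. -/
def GroupFamily.ClosedUnderFiniteIndex (C : GroupFamily.{u}) : Prop :=
  ∀ (G : Type u) [Group G], C G → ∀ H : Subgroup G, H.FiniteIndex → C H

/-- A multiplicative invariant on a family of groups: a function of the isomorphism type of the
group that is multiplied by the index on passing to a finite-index subgroup. -/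
structure GroupFamily.IsMultiplicativeInvariant (C : GroupFamily.{u}) (ρ : C.RealFunction) :
    Prop where
  eq_of_mulEquiv : ∀ (G H : Type u) [Group G] [Group H] (hG : C G) (hH : C H),
    Nonempty (G ≃* H) → ρ G hG = ρ H hH
  subgroup_eq : ∀ (G : Type u) [Group G] (hG : C G) (H : Subgroup G) (hH : C H),
    H.FiniteIndex → ρ H hH = (H.index : ℝ) * ρ G hG

/-- A decomposition `G ≅ G₁ * ⋯ * Gₙ * F_r` with all `Gᵢ` in the family `C`. -/
structure FreeProductDecomposition (C : GroupFamily.{u}) (G : Type u) [Group G] where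
  n : ℕ
  r : ℕ
  factor : Fin n → Type u
  [group : ∀ i, Group (factor i)]
  factor_mem : ∀ i, C (factor i)
  equiv : G ≃* Monoid.Coprod (Monoid.CoprodI factor) (FreeGroup (Fin r))

attribute [instance] FreeProductDecomposition.group

/-- The number `1 - r - n + ∑ ρ(Gᵢ)` attached to a decomposition `G ≅ G₁ * ⋯ * Gₙ * F_r`. -/
noncomputable def FreeProductDecomposition.value {C : GroupFamily.{u}} {G : Type u} [Group G]
    (d : FreeProductDecomposition C G) (ρ : C.RealFunction) : ℝ :=
  1 - (d.r : ℝ) - (d.n : ℝ) + ∑ i, ρ (d.factor i) (d.factor_mem i)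

/-- The family of all groups of the form `G₁ * ⋯ * Gₙ * F_r` with `n, r ≥ 0` and `Gᵢ` in `C`. -/
def GroupFamily.freeProducts (C : GroupFamily.{u}) : GroupFamily.{u} :=
  fun G _ => Nonempty (FreeProductDecomposition C G)

/-- The function `χ_ρ (G₁ * ⋯ * Gₙ * F_r) = 1 - r - n + ∑ ρ(Gᵢ)`, evaluated on some decomposition
of the group. That every decomposition gives the same number is a claim of the theorem. -/
noncomputable def chiRho {C : GroupFamily.{u}} (ρ : C.RealFunction) :
    C.freeProducts.RealFunction :=
  fun _ _ hG => (Classical.choice hG).value ρ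

/-! Well-definedness is the uniqueness of the factors. A one-ended group is infinite and its almost
invariant subsets are finite or cofinite. Let such a group `G` embed in a finite free product, and
consider the tree whose vertices are the elements of the product and the cosets of its factors. At
each element the directions cut `G` into almost invariant sets, so exactly one direction contains
almost all of `G`. Following these directions either leads to a sink or escapes to an end; the
second case yields a translation whose inverse powers are infinitely many elements on the light
side, which is absurd. The sink is a unique coset, hence fixed by `G`, so `G` is conjugate into a
factor (`exists_conj_mem_range`). Such a `G` does not embed in a free group. An isomorphism of two
decompositions thus matches the factors, and killing them leaves isomorphic free groups
(`exists_equiv_of_coprod_mulEquiv`).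

A finite-index subgroup is a point stabilizer for an action on a set `X` whose size is the index.
The Kurosh theorem in explicit form (`stabilizerEquiv`) writes it as a free product of one
stabilizer per `Gᵢ`-orbit and a free group on the edges outside a spanning tree. For each `i` the
orbit lengths, which are the indices of these stabilizers, add up to `|X|`; this scales the
`ρ`-terms. Counting edges (`card_edge_add`) scales `1 - r - n`. -/

/-! ### Ends of graphs. -/

/-- Every infinite component of the complement of a finite set is selected by some end. -/
theorem SimpleGraph.exists_end_apply_eq {V : Type u} (Γ : SimpleGraph V)
    [Infinite V] [Γ.LocallyFinite] [Fact Γ.Preconnected] (K : Finset V)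
    (D : Γ.ComponentCompl K) (hD : D.supp.Infinite) :
    ∃ e : Γ.end, e.1 (Opposite.op K) = D := by
  let F := Γ.componentComplFunctor
  have hfin : ∀ L, Finite (F.obj L) := fun L => Γ.componentCompl_finite L.unop
  have hne : ∀ L, Nonempty (F.obj L) := fun L => Γ.componentCompl_nonempty_of_infinite L.unop
  have hML : F.IsMittagLeffler := F.isMittagLeffler_of_exists_finite_range
    fun j => ⟨j, CategoryTheory.CategoryStruct.id j, Set.toFinite _⟩
  have hne' := fun j => F.toEventualRanges_nonempty hML j
  -- An infinite component lies in the eventual range; there the transition maps are surjective, so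
  -- it extends to a section.
  obtain ⟨s, hs⟩ := F.toEventualRanges.eval_section_surjective_of_surjective
    (F.surjective_toEventualRanges hML) (Opposite.op K)
    ⟨D, (Γ.infinite_iff_in_eventualRange (K := Opposite.op K) D).1 hD⟩
  exact ⟨F.toEventualRangesSectionsEquiv s, congrArg Subtype.val hs⟩

/-- If `A` and its complement are infinite and only finitely many vertices of `A` have a neighbour
outside `A`, then the graph has two distinct ends. -/
theorem SimpleGraph.exists_end_ne_end {V : Type u} (Γ : SimpleGraph V)
    [Γ.LocallyFinite] [Fact Γ.Preconnected] (A : Set V) (hA : A.Infinite) (hA' : Aᶜ.Infinite)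
    (hfin : {x | x ∈ A ∧ ∃ y, Γ.Adj x y ∧ y ∉ A}.Finite) :
    ∃ e e' : Γ.end, e ≠ e' := by
  have : Infinite V := Set.infinite_univ_iff.1 (hA.mono (Set.subset_univ _))
  let K : Finset V := hfin.toFinset
  have hK : ∀ x, x ∈ K ↔ x ∈ A ∧ ∃ y, Γ.Adj x y ∧ y ∉ A := fun x => by simp [K]
  -- Every edge leaving `A` has an endpoint in `K`, so a component of the complement of `K` lies on
  -- one side of `A`.
  let side : Γ.ComponentCompl K → Prop := ComponentCompl.lift (fun v _ => v ∈ A) (by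
    intro v w hv hw hvw
    simp only [Finset.mem_coe, hK] at hv hw
    refine propext ⟨fun h => ?_, fun h => ?_⟩
    · by_contra hw'
      exact hv ⟨h, w, hvw, hw'⟩
    · by_contra hv'
      exact hw ⟨h, v, hvw.symm, hv'⟩)
  have key : ∀ B : Set V, B.Infinite → ∃ D : Γ.ComponentCompl K, (D.supp ∩ B).Infinite := by
    intro B hB
    by_contra! h
    have hsub : B ⊆ (K : Set V) ∪ ⋃ D : Γ.ComponentCompl K, (D.supp ∩ B) := by
      intro v hv
      by_cases hvK : v ∈ (K : Set V)
      · exact Or.inl hvK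
      · exact Or.inr (Set.mem_iUnion.2 ⟨Γ.componentComplMk hvK, ⟨hvK, rfl⟩, hv⟩)
    have := Γ.componentCompl_finite K
    exact hB ((K.finite_toSet.union (Set.finite_iUnion h)).subset
      hsub)
  obtain ⟨D, hD⟩ := key A hA
  obtain ⟨D', hD'⟩ := key Aᶜ hA'
  obtain ⟨e, he⟩ := Γ.exists_end_apply_eq K D (hD.mono Set.inter_subset_left)
  obtain ⟨e', he'⟩ := Γ.exists_end_apply_eq K D' (hD'.mono Set.inter_subset_left)
  refine ⟨e, e', ?_⟩
  rintro rfl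
  have hDD : D = D' := he.symm.trans he'
  obtain ⟨v, ⟨hv, hvD⟩, hvA⟩ := hD.nonempty
  obtain ⟨w, ⟨hw, hwD⟩, hwA⟩ := hD'.nonempty
  have h1 : side D = (v ∈ A) := by rw [← hvD]; rfl
  have h2 : side D' = (w ∈ A) := by rw [← hwD]; rfl
  rw [← hDD, h1] at h2
  exact hwA (h2 ▸ hvA)

/-! ### Almost invariant subsets and one-ended groups. -/

/-- A subset of a group is almost invariant if every right translate differs from it by a finite
set. -/
def IsAlmostInvariant {G : Type*} [Group G] (A : Set G) : Prop :=
  ∀ g, {x | ¬(x ∈ A ↔ x * g ∈ A)}.Finite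

/-- A group is almost indecomposable if it is infinite and has no almost invariant subsets
other than the finite and the cofinite ones. -/
structure IsAlmostIndecomposable (G : Type*) [Group G] : Prop where
  infinite : Infinite G
  finite_or_compl_finite : ∀ A : Set G, IsAlmostInvariant A → A.Finite ∨ Aᶜ.Finite

theorem SimpleGraph.preconnected_mulCayley {G : Type*} [Group G] {S : Set G}
    (hS : Subgroup.closure S = ⊤) : (SimpleGraph.mulCayley S).Preconnected := by
  have step : ∀ g : G, ∀ x, (SimpleGraph.mulCayley S).Reachable x (x * g) := by
    intro g
    induction (hS ▸ Subgroup.mem_top g : g ∈ Subgroup.closure S) using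
      Subgroup.closure_induction with
    | mem s hs =>
      intro x
      by_cases h : x = x * s
      · rw [← h]
      · exact SimpleGraph.Adj.reachable ((mulCayley_adj _ _ _).2 ⟨h, Or.inl (by simpa using hs)⟩)
    | one => intro x; rw [mul_one]
    | mul a b _ _ ha hb => intro x; rw [← mul_assoc]; exact (ha x).trans (hb _)
    | inv a _ ha => intro x; simpa using (ha (x * a⁻¹)).symm
  intro x y
  simpa using step (x⁻¹ * y) x

/-- The Cayley graph joins `x` to `x * s`, so an almost invariant set has finite boundary, and if it
and its complement were infinite there would be two ends. A finite group has no end, since removing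
all vertices leaves no component. -/
theorem IsOneEnded.isAlmostIndecomposable {G : Type u} [Group G] (hG : IsOneEnded G) :
    IsAlmostIndecomposable G := by
  obtain ⟨S, hS, hgen, hcard⟩ := hG
  obtain ⟨hsub, ⟨e⟩⟩ := Nat.card_eq_one_iff_unique.1 hcard
  refine ⟨?_, fun A hA => ?_⟩
  · by_contra hfin
    rw [not_infinite_iff_finite] at hfin
    have := Fintype.ofFinite G
    obtain ⟨v, hv⟩ := (e.1 (Opposite.op Finset.univ)).nonempty
    exact hv.choose (by simp)
  · have : Fact (SimpleGraph.mulCayley S).Preconnected :=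
      ⟨SimpleGraph.preconnected_mulCayley hgen⟩
    have : (SimpleGraph.mulCayley S).LocallyFinite := fun v => by
      refine Set.Finite.fintype (((hS.image (v * ·)).union (hS.image (v * ·⁻¹))).subset ?_)
      intro w hw
      rcases ((SimpleGraph.mulCayley_adj _ _ _).1 hw).2 with h | h
      · exact Or.inl ⟨_, h, by simp⟩
      · exact Or.inr ⟨_, h, by simp⟩
    by_contra! h
    obtain ⟨e, e', hne⟩ := (SimpleGraph.mulCayley S).exists_end_ne_end A h.1 h.2 (by
      refine ((hS.biUnion fun s _ => hA s).union (hS.biUnion fun s _ => hA s⁻¹)).subset ?_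
      rintro x ⟨hx, y, hxy, hy⟩
      rcases ((SimpleGraph.mulCayley_adj _ _ _).1 hxy).2 with h | h
      · exact Or.inl (Set.mem_biUnion h (by simp [hx, hy]))
      · exact Or.inr (Set.mem_biUnion h (by simp [hx, hy])))
    exact hne (hsub.elim _ _)
-- First letters of reduced words in a free product.
namespace Monoid.CoprodI

variable {ι : Type*} {K : ι → Type*} [∀ i, Group (K i)]

open Classical in
/-- The elements of a free product whose reduced word starts with a letter of the `j`-th factor. -/
def startsIn (K : ι → Type*) [∀ i, Group (K i)] (j : ι) : Set (CoprodI K) :=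
  {p | (Word.equiv p).fstIdx = some j}

theorem one_notMem_startsIn (j : ι) : (1 : CoprodI K) ∉ startsIn K j := by
  classical
  simp only [startsIn, Set.mem_ofPred_eq, Word.equiv, Equiv.coe_fn_mk, one_smul]
  simp [Word.fstIdx]

theorem eq_of_mem_startsIn {i j : ι} {p : CoprodI K} (hi : p ∈ startsIn K i)
    (hj : p ∈ startsIn K j) : i = j := by
  classical
  exact Option.some_injective _ (hi.symm.trans hj)

theorem of_mul_mem_startsIn {i : ι} {k : K i} (hk : k ≠ 1) {p : CoprodI K}
    (hp : p ∉ startsIn K i) : of k * p ∈ startsIn K i := by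
  classical
  replace hp : (Word.equiv p).fstIdx ≠ some i := hp
  have : Word.equiv (of k * p) = Word.cons k (Word.equiv p) hp hk := by
    rw [Word.cons_eq_smul]
    exact mul_smul (of k) p (Word.empty : Word K)
  change (Word.equiv (of k * p)).fstIdx = some i
  rw [this, Word.fstIdx_cons]

/-- Induction on the reduced word of an element of a free product. -/
theorem reduced_induction {motive : CoprodI K → Prop} (p : CoprodI K) (one : motive 1)
    (of_mul : ∀ (i : ι) (k : K i) (q : CoprodI K), k ≠ 1 → q ∉ startsIn K i → motive q →
      motive (of k * q)) : motive p := by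
  classical
  obtain ⟨w, rfl⟩ := (Word.equiv (M := K)).symm.surjective p
  induction w using Word.consRecOn with
  | empty => exact one
  | cons i k w h1 h2 ih =>
    have : (Word.equiv (M := K)).symm (Word.cons k w h1 h2) = of k * Word.equiv.symm w :=
      Word.prod_cons i k w h2 h1
    rw [this]
    refine of_mul i k _ h2 ?_ ih
    intro h
    apply h1
    simpa [startsIn] using h

theorem eq_one_or_mem_startsIn (p : CoprodI K) : p = 1 ∨ ∃ j, p ∈ startsIn K j := by
  induction p using reduced_induction with
  | one => exact Or.inl rfl
  | of_mul i k q hk hq _ => exact Or.inr ⟨i, of_mul_mem_startsIn hk hq⟩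

theorem exists_eq_of_mul {i : ι} {p : CoprodI K} (hp : p ∈ startsIn K i) :
    ∃ (k : K i) (q : CoprodI K), k ≠ 1 ∧ q ∉ startsIn K i ∧ p = of k * q := by
  induction p using reduced_induction with
  | one => exact absurd hp (one_notMem_startsIn i)
  | of_mul j k q hk hq _ =>
    obtain rfl := eq_of_mem_startsIn hp (of_mul_mem_startsIn hk hq)
    exact ⟨k, q, hk, hq, rfl⟩

theorem exists_of_mul_notMem_startsIn (i : ι) (p : CoprodI K) :
    ∃ k : K i, of k * p ∉ startsIn K i := by
  by_cases hp : p ∈ startsIn K i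
  · obtain ⟨k, q, -, hq, rfl⟩ := exists_eq_of_mul hp
    exact ⟨k⁻¹, by simpa [← mul_assoc, ← map_mul] using hq⟩
  · exact ⟨1, by simpa using hp⟩

theorem of_mem_startsIn {i : ι} {k : K i} (hk : k ≠ 1) : of k ∈ startsIn K i := by
  simpa using of_mul_mem_startsIn hk (one_notMem_startsIn i)

/-- Right multiplication by a letter affects only the end of a reduced word, so it can introduce a
new first factor only when the word is empty. -/
theorem eq_one_of_mul_of_mem_startsIn {i : ι} (s : K i) (q : CoprodI K) :
    ∀ j, q ∉ startsIn K j → q * of s ∈ startsIn K j → q = 1 ∧ i = j := by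
  have base : ∀ j, of s ∈ startsIn K j → i = j := by
    intro j h
    by_cases hs : s = 1
    · subst hs
      rw [map_one] at h
      exact absurd h (one_notMem_startsIn j)
    · exact eq_of_mem_startsIn (of_mem_startsIn hs) h
  induction q using reduced_induction with
  | one => exact fun j _ h => ⟨rfl, base j (by simpa using h)⟩
  | of_mul l k q hk hq ih =>
    intro j hj h
    exfalso
    rw [mul_assoc] at h
    by_cases hqs : q * of s ∈ startsIn K l
    · obtain ⟨rfl, rfl⟩ := ih l hq hqs
      rw [one_mul, ← map_mul] at h
      by_cases hks : k * s = 1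
      · rw [hks, map_one] at h
        exact one_notMem_startsIn j h
      · obtain rfl := eq_of_mem_startsIn h (of_mem_startsIn hks)
        exact hj (of_mul_mem_startsIn hk hq)
    · obtain rfl := eq_of_mem_startsIn h (of_mul_mem_startsIn hk hqs)
      exact hj (of_mul_mem_startsIn hk hq)

theorem mul_of_eq_one_of_notMem_startsIn {i j : ι} (s : K i) (p : CoprodI K)
    (hp : p ∈ startsIn K j) (h : p * of s ∉ startsIn K j) : p * of s = 1 := by
  refine (eq_one_of_mul_of_mem_startsIn s⁻¹ (p * of s) j h ?_).1
  simpa [mul_assoc, ← map_mul] using hp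

/-- The condition on `u⁻¹` says that `u` does not end in the `j`-th factor, so nothing cancels or
merges in `u * y`. -/
theorem mul_mem_startsIn {j : ι} {y : CoprodI K} (hy : y ∈ startsIn K j) (u : CoprodI K) :
    ∀ l, u ∈ startsIn K l → u⁻¹ ∉ startsIn K j → u * y ∈ startsIn K l := by
  induction u using reduced_induction with
  | one => exact fun l h => absurd h (one_notMem_startsIn l)
  | of_mul i k u hk hu ih =>
    intro l hl hinv
    have hi := of_mul_mem_startsIn hk hu
    obtain rfl := eq_of_mem_startsIn hi hl
    rw [mul_assoc]
    refine of_mul_mem_startsIn hk ?_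
    rcases eq_one_or_mem_startsIn u with rfl | ⟨m, hm⟩
    · rw [one_mul]
      intro hy'
      obtain rfl := eq_of_mem_startsIn hy hy'
      apply hinv
      simpa using of_mem_startsIn (inv_ne_one.2 hk)
    · have hu' : u⁻¹ ∉ startsIn K j := by
        intro h
        have h1 := mul_of_eq_one_of_notMem_startsIn k⁻¹ u⁻¹ h (by simpa using hinv)
        have h2 : of k * u = 1 := by
          rw [← inv_eq_one, mul_inv_rev, ← map_inv, h1]
        rw [h2] at hi
        exact one_notMem_startsIn i hi
      intro h
      exact hu (eq_of_mem_startsIn h (ih m hm hu') ▸ hm)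

/-- For a single letter the exceptions are only `1` and the inverse letter; finiteness of the
exceptions passes to products. -/
theorem isAlmostInvariant_startsIn (j : ι) : IsAlmostInvariant (startsIn K j) := by
  intro g
  induction g using CoprodI.induction_on with
  | one => simp
  | of i s =>
    refine Set.Finite.subset (s := {1, (of s)⁻¹}) (by simp) ?_
    intro p hp
    simp only [Set.mem_ofPred_eq] at hp
    by_cases h : p ∈ startsIn K j
    · right
      exact eq_inv_of_mul_eq_one_left (mul_of_eq_one_of_notMem_startsIn s p h (by tauto))
    · left
      exact (eq_one_of_mul_of_mem_startsIn s p j h (by tauto)).1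
  | mul a b ha hb =>
    refine (ha.union (hb.preimage (mul_left_injective a).injOn)).subset ?_
    intro p hp
    simp only [Set.mem_ofPred_eq, Set.mem_union, Set.mem_preimage, mul_assoc] at hp ⊢
    tauto

end Monoid.CoprodI
-- Heavy directions and conjugation into a factor.
namespace Monoid.CoprodI

variable {ι : Type*} {K : ι → Type*} [∀ i, Group (K i)] {G : Type*} [Group G]

/-- The elements `x` of `G` such that the reduced word leading from `a` to `φ x` starts in the
`j`-th factor. -/
def halfSpace (φ : G →* CoprodI K) (a : CoprodI K) (j : ι) : Set G :=
  {x | a⁻¹ * φ x ∈ startsIn K j}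

theorem mem_halfSpace {φ : G →* CoprodI K} {a : CoprodI K} {j : ι} {x : G} :
    x ∈ halfSpace φ a j ↔ a⁻¹ * φ x ∈ startsIn K j := Iff.rfl

theorem isAlmostInvariant_halfSpace {φ : G →* CoprodI K} (hφ : Function.Injective φ)
    (a : CoprodI K) (j : ι) : IsAlmostInvariant (halfSpace φ a j) := by
  intro g
  have hinj : Function.Injective fun x => a⁻¹ * φ x := (mul_right_injective _).comp hφ
  refine ((isAlmostInvariant_startsIn j (φ g)).preimage hinj.injOn).subset ?_
  intro x hx
  simpa [mem_halfSpace, mul_assoc] using hx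

/-- At `a`, the `j`-th direction contains all but finitely many elements of `G`. -/
def IsHeavy (φ : G →* CoprodI K) (a : CoprodI K) (j : ι) : Prop :=
  (halfSpace φ a j)ᶜ.Finite

section

variable {φ : G →* CoprodI K} (hφ : Function.Injective φ) (hG : IsAlmostIndecomposable G)

include hφ hG in
theorem finite_halfSpace_of_not_isHeavy {a : CoprodI K} {j : ι} (h : ¬IsHeavy φ a j) :
    (halfSpace φ a j).Finite :=
  (hG.finite_or_compl_finite _ (isAlmostInvariant_halfSpace hφ a j)).resolve_right h

include hG in
theorem false_of_finite_cover {A B : Set G} (hA : A.Finite) (hB : B.Finite)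
    (h : ∀ x, x ∈ A ∨ x ∈ B) : False := by
  have := hG.infinite
  exact Set.infinite_univ ((hA.union hB).subset fun x _ => h x)

include hG in
theorem IsHeavy.exists_mem {a b : CoprodI K} {i j : ι} (hi : IsHeavy φ a i) (hj : IsHeavy φ b j) :
    ∃ x, x ∈ halfSpace φ a i ∧ x ∈ halfSpace φ b j := by
  by_contra! h
  exact false_of_finite_cover hG hi hj fun x => by
    by_cases hx : x ∈ halfSpace φ a i
    · exact Or.inr (h x hx)
    · exact Or.inl hx

include hG in
theorem IsHeavy.unique {a : CoprodI K} {i j : ι} (hi : IsHeavy φ a i) (hj : IsHeavy φ a j) :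
    i = j := by
  obtain ⟨x, hx, hx'⟩ := hi.exists_mem hG hj
  exact eq_of_mem_startsIn hx hx'

-- Apart from at most one `x` with `φ x = a`, the directions at `a` cover `G`; as there are finitely
-- many, they cannot all be finite.
include hφ hG in
theorem exists_isHeavy [Finite ι] (a : CoprodI K) : ∃ j, IsHeavy φ a j := by
  by_contra! h
  refine false_of_finite_cover hG (A := φ ⁻¹' {a}) (B := ⋃ j, halfSpace φ a j)
    ((Set.finite_singleton a).preimage hφ.injOn)
    (Set.finite_iUnion fun j => finite_halfSpace_of_not_isHeavy hφ hG (h j)) fun x => ?_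
  rcases eq_one_or_mem_startsIn (a⁻¹ * φ x) with h | ⟨j, hj⟩
  · exact Or.inl (inv_mul_eq_one.1 h).symm
  · exact Or.inr (Set.mem_iUnion.2 ⟨j, hj⟩)

theorem IsHeavy.mono {a b : CoprodI K} {i j : ι} (h : IsHeavy φ a i)
    (hsub : ∀ p, a⁻¹ * p ∈ startsIn K i → b⁻¹ * p ∈ startsIn K j) : IsHeavy φ b j :=
  h.subset (Set.compl_subset_compl.2 fun x hx => hsub (φ x) hx)

theorem IsHeavy.smul {a : CoprodI K} {j : ι} (h : IsHeavy φ a j) (x : G) :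
    IsHeavy φ (φ x * a) j := by
  refine (h.preimage (mul_right_injective x⁻¹).injOn).subset fun y hy hy' => hy ?_
  rw [mem_halfSpace] at hy' ⊢
  simpa [mul_assoc] using hy'

theorem isHeavy_smul_iff {a : CoprodI K} {j : ι} (x : G) :
    IsHeavy φ (φ x * a) j ↔ IsHeavy φ a j :=
  ⟨fun h => by simpa [← mul_assoc, ← map_mul] using h.smul x⁻¹, fun h => h.smul x⟩

-- Seen from two different elements of a coset of `K j`, every point lies in the `j`-th direction of
-- at least one of them. So at most one element of a coset points away from it.
include hφ hG in
theorem isHeavy_mul_of_unique {a : CoprodI K} {j : ι} {k k' : K j}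
    (hk : ¬IsHeavy φ (a * of k) j) (hk' : ¬IsHeavy φ (a * of k') j) : k = k' := by
  by_contra hne
  refine false_of_finite_cover hG (finite_halfSpace_of_not_isHeavy hφ hG hk)
    (finite_halfSpace_of_not_isHeavy hφ hG hk') fun x => ?_
  by_contra! h
  apply h.1
  have := of_mul_mem_startsIn (k := k⁻¹ * k') (fun h => hne (inv_mul_eq_one.1 h)) h.2
  rw [mem_halfSpace]
  simpa [mul_assoc] using this

include hG in
/-- If all directions at two cosets of the `j`-th factor point towards the coset, then the cosets
agree. -/
theorem inv_mul_mem_range_of_isHeavy {a b : CoprodI K} {j : ι}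
    (ha : ∀ k : K j, IsHeavy φ (a * of k) j) (hb : ∀ k : K j, IsHeavy φ (b * of k) j) :
    a⁻¹ * b ∈ (of : K j →* CoprodI K).range := by
  by_contra hw
  obtain ⟨k, hk⟩ := exists_of_mul_notMem_startsIn j (a⁻¹ * b)
  obtain ⟨k', hk'⟩ := exists_of_mul_notMem_startsIn j (of k * (a⁻¹ * b))⁻¹
  -- `u` leads from `a * of k⁻¹` to `b * of k'⁻¹`; `k` and `k'` are chosen so that it neither starts
  -- nor ends in the `j`-th factor.
  set u : CoprodI K := of k * (a⁻¹ * b) * of k'⁻¹ with hu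
  have hu1 : ∀ l : K j, u ≠ of l := by
    intro l hl
    refine hw ⟨k⁻¹ * l * k', ?_⟩
    rw [map_mul, map_mul, ← hl, hu]
    simp [mul_assoc]
  have hu2 : u ∉ startsIn K j := fun h => by
    have := (eq_one_of_mul_of_mem_startsIn k'⁻¹ _ j hk h).1
    exact hu1 k'⁻¹ (by rw [hu, this, one_mul])
  have hu3 : u⁻¹ ∉ startsIn K j := by
    rw [hu, mul_inv_rev, map_inv, inv_inv]
    exact hk'
  obtain ⟨l, hl⟩ := (eq_one_or_mem_startsIn u).resolve_left fun h => hu1 1 (by rw [h, map_one])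
  obtain ⟨x, hx, hx'⟩ := (ha k⁻¹).exists_mem hG (hb k'⁻¹)
  rw [mem_halfSpace] at hx hx'
  have h1 := mul_mem_startsIn hx' u l hl hu3
  have h2 : u * ((b * of k'⁻¹)⁻¹ * φ x) = (a * of k⁻¹)⁻¹ * φ x := by
    rw [hu]
    simp [mul_assoc]
  rw [h2] at h1
  obtain rfl := eq_of_mem_startsIn h1 hx
  exact hu2 hl

include hφ hG in
/-- The orientation of the free product by heavy directions has a sink. -/
theorem exists_forall_isHeavy [Finite ι] :
    ∃ (a : CoprodI K) (j : ι), ∀ k : K j, IsHeavy φ (a * of k) j := by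
  have := hG.infinite
  by_contra! hno
  choose J hJ using exists_isHeavy hφ hG
  choose κ hκ using fun a => hno a (J a)
  -- Without a sink, the coset to which `a` points contains an element pointing away from it, and
  -- `next` moves there.
  let next : CoprodI K → CoprodI K := fun a => a * of (κ a)
  have hJeq : ∀ {a j}, IsHeavy φ a j → J a = j := fun h => (hJ _).unique hG h
  have hJnext : ∀ a, J (next a) ≠ J a := fun a h => hκ a (by
    have := hJ (next a)
    rwa [h] at this)
  have hκ1 : ∀ a, κ a ≠ 1 := fun a h => hκ a (by rw [h, map_one, mul_one]; exact hJ a)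
  have next_eq : ∀ (a : CoprodI K) (j : ι) (k : K j), IsHeavy φ a j →
      ¬IsHeavy φ (a * of k) j → next a = a * of k := by
    intro a j k h hk
    obtain rfl := hJeq h
    simp only [next, isHeavy_mul_of_unique hφ hG (hκ a) hk]
  have next_smul : ∀ (x : G) a, next (φ x * a) = φ x * next a := by
    intro x a
    rw [next_eq (φ x * a) (J a) (κ a) ((hJ a).smul x) (by
      rw [mul_assoc, isHeavy_smul_iff]; exact hκ a), mul_assoc]
  have iter_smul : ∀ (n : ℕ) (x : G) a, next^[n] (φ x * a) = φ x * next^[n] a := by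
    intro n x a
    exact (Function.Semiconj.iterate_right (f := (φ x * ·)) (fun a => (next_smul x a).symm) n a).symm
  -- Every iterate has its starting point behind it, outside its heavy direction, so the flow never
  -- returns.
  have back : ∀ (n : ℕ) c, (next^[n] c)⁻¹ * c ∉ startsIn K (J (next^[n] c)) ∧
      (0 < n → next^[n] c ≠ c) := by
    intro n c
    induction n with
    | zero => exact ⟨by simpa using one_notMem_startsIn _, fun h => absurd h (lt_irrefl 0)⟩
    | succ n ih =>
      rw [Function.iterate_succ_apply']
      set b := next^[n] c
      have hmem : (next b)⁻¹ * c ∈ startsIn K (J b) := by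
        have := of_mul_mem_startsIn (inv_ne_one.2 (hκ1 b)) ih.1
        simpa [next, mul_assoc] using this
      refine ⟨fun h => hJnext b (eq_of_mem_startsIn h hmem), fun _ h => ?_⟩
      rw [h, inv_mul_cancel] at hmem
      exact one_notMem_startsIn _ hmem
  -- Any two flow lines meet: by induction it suffices to compare two elements `a` and `a * of k` of
  -- one coset.
  have merge : ∀ g a : CoprodI K, ∃ p q : ℕ, next^[p] a = next^[q] (a * g) := by
    intro g
    induction g using CoprodI.induction_on with
    | one => exact fun a => ⟨0, 0, by simp⟩
    | of i k =>
      intro a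
      by_cases hk : k = 1
      · exact ⟨0, 0, by simp [hk]⟩
      by_cases h1 : IsHeavy φ a i
      · by_cases h2 : IsHeavy φ (a * of k) i
        · refine ⟨1, 1, ?_⟩
          obtain rfl := hJeq h1
          have := next_eq (a * of k) _ (k⁻¹ * κ a) h2 (by
            simpa [mul_assoc, ← map_mul] using hκ a)
          simpa [mul_assoc, ← map_mul, next] using this.symm
        · exact ⟨1, 0, next_eq a i k h1 h2⟩
      · refine ⟨0, 1, ?_⟩
        have h2 : IsHeavy φ (a * of k) i := by
          refine (hJ a).mono fun p hp => ?_
          have := of_mul_mem_startsIn (k := k⁻¹) (inv_ne_one.2 hk) (p := a⁻¹ * p) fun h =>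
            h1 (eq_of_mem_startsIn h hp ▸ hJ a)
          simpa [mul_assoc] using this
        have := next_eq (a * of k) i k⁻¹ h2 (by simpa [mul_assoc, ← map_mul] using h1)
        simpa [mul_assoc, ← map_mul] using this.symm
    | mul g h hg hh =>
      intro a
      obtain ⟨p, q, h1⟩ := hg a
      obtain ⟨p', q', h2⟩ := hh (a * g)
      refine ⟨p' + p, q + q', ?_⟩
      rw [← mul_assoc, Function.iterate_add_apply, h1, ← Function.iterate_add_apply, add_comm p',
        Function.iterate_add_apply, h2, ← Function.iterate_add_apply]
  -- The flow lines of `1` and `φ x` merge, which makes `x` or `x⁻¹` a translation along a flow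
  -- line; equal times would force `φ x = 1`.
  have shift : ∃ (x : G) (b : CoprodI K) (m : ℕ), 0 < m ∧ φ x * b = next^[m] b := by
    obtain ⟨x, hx⟩ := exists_ne (1 : G)
    obtain ⟨p, q, h⟩ := merge (φ x) 1
    rw [one_mul, ← mul_one (φ x), iter_smul] at h
    rcases lt_trichotomy p q with hpq | rfl | hpq
    · refine ⟨x⁻¹, next^[p] 1, q - p, by omega, ?_⟩
      rw [← Function.iterate_add_apply, Nat.sub_add_cancel hpq.le, h, ← mul_assoc, ← map_mul]
      simp
    · exact absurd (hφ (by simpa using h.symm : φ x = φ 1)) hx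
    · refine ⟨x, next^[q] 1, p - q, by omega, ?_⟩
      rw [← Function.iterate_add_apply, Nat.sub_add_cancel hpq.le, h]
  obtain ⟨x, b, m, hm, hx⟩ := shift
  have hpow : ∀ i : ℕ, φ (x ^ i) * b = next^[m * i] b := by
    intro i
    induction i with
    | zero => simp
    | succ i ih =>
      rw [pow_succ, map_mul, mul_assoc, hx, ← iter_smul, ih, ← Function.iterate_add_apply,
        mul_add_one, add_comm m]
  have hinj : Function.Injective fun i : ℕ => x⁻¹ ^ i := by
    rw [injective_pow_iff_not_isOfFinOrder, isOfFinOrder_inv_iff, isOfFinOrder_iff_pow_eq_one]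
    rintro ⟨i, hi, h1⟩
    have := hpow i
    rw [h1, map_one, one_mul] at this
    exact (back (m * i) b).2 (Nat.mul_pos hm hi) this.symm
  -- Heaviness concerns `b⁻¹ * φ y`; by almost invariance, right translation by `b` changes the set
  -- only finitely.
  have hfin : {y : G | b⁻¹ * (φ y * b) ∉ startsIn K (J b)}.Finite := by
    have h1 : (halfSpace φ b (J b))ᶜ.Finite := hJ b
    have h2 := (isAlmostInvariant_startsIn (K := K) (J b) b).preimage
      ((mul_right_injective b⁻¹).comp hφ).injOn
    refine (h1.union h2).subset fun y hy => ?_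
    simp only [Set.mem_union, Set.mem_compl_iff, mem_halfSpace, Set.mem_preimage,
      Set.mem_ofPred_eq, Function.comp_apply, mul_assoc] at hy ⊢
    tauto
  -- The translates of `b` by powers of `x⁻¹` flow into `b`, so `back` puts infinitely many elements
  -- into the finite set `hfin`.
  refine Set.infinite_range_of_injective hinj (hfin.subset ?_)
  rintro _ ⟨i, rfl⟩
  have hc := iter_smul (m * i) (x⁻¹ ^ i) b
  rw [← hpow, ← mul_assoc, ← map_mul] at hc
  simp only [inv_pow, inv_mul_cancel, map_one, one_mul] at hc
  have := (back (m * i) (φ (x⁻¹ ^ i) * b)).1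
  simp only [inv_pow] at this
  rw [hc] at this
  simpa using this

include hφ hG in
/-- An infinite group without proper almost invariant subsets that embeds into a free product of
finitely many groups is conjugate into a factor. -/
theorem exists_conj_mem_range [Finite ι] :
    ∃ (j : ι) (a : CoprodI K), ∀ x, a⁻¹ * φ x * a ∈ (of : K j →* CoprodI K).range := by
  obtain ⟨a, j, h⟩ := exists_forall_isHeavy hφ hG
  refine ⟨j, a, fun x => ?_⟩
  rw [mul_assoc]
  exact inv_mul_mem_range_of_isHeavy hG h fun k => by
    rw [mul_assoc]; exact (h k).smul x

end

end Monoid.CoprodI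
-- Embeddings into a free product with a free factor.
universe v w

open Monoid

theorem MonoidHom.exists_injective_lift_conj {G P K : Type*} [Group G] [Group P] [Group K]
    {φ : G →* P} (hφ : Function.Injective φ) {f : K →* P} (hf : Function.Injective f) {a : P}
    (h : ∀ x, a⁻¹ * φ x * a ∈ f.range) :
    ∃ ψ : G →* K, Function.Injective ψ ∧ ∀ x, f (ψ x) = a⁻¹ * φ x * a := by
  let χ : G →* P := (MulAut.conj a⁻¹).toMonoidHom.comp φ
  have hχ : ∀ x, χ x = a⁻¹ * φ x * a := fun x => by simp [χ]
  let ψ : G →* K := (MonoidHom.ofInjective hf).symm.toMonoidHom.comp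
    (χ.codRestrict f.range fun x => hχ x ▸ h x)
  have hψ : ∀ x, f (ψ x) = a⁻¹ * φ x * a := fun x => by
    rw [← hχ]
    exact congrArg Subtype.val ((MonoidHom.ofInjective hf).apply_symm_apply
      (χ.codRestrict f.range (fun x => hχ x ▸ h x) x))
  refine ⟨ψ, fun x y hxy => hφ ?_, hψ⟩
  have := congrArg f hxy
  rw [hψ, hψ] at this
  simpa using this

/-- Two groups as a family indexed by `Bool`. -/
def CoprodPair (A : Type v) (B : Type w) : Bool → Type max v w
  | false => ULift.{w} A
  | true => ULift.{v} B

instance (A : Type v) (B : Type w) [Group A] [Group B] : ∀ b, Group (CoprodPair A B b)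
  | false => inferInstanceAs (Group (ULift.{w} A))
  | true => inferInstanceAs (Group (ULift.{v} B))

namespace IsAlmostIndecomposable

variable {G : Type*} [Group G]

/-- The nonnegative elements form an almost invariant set, and inversion exchanges signs, so neither
this set nor its complement is finite. -/
theorem not_injective_int (hG : IsAlmostIndecomposable G) (φ : G →* Multiplicative ℤ) :
    ¬Function.Injective φ := by
  intro hφ
  have := hG.infinite
  let f : G → ℤ := fun x => (φ x).toAdd
  have hf : Function.Injective f := hφ
  have hmul : ∀ x y, f (x * y) = f x + f y := fun x y => by simp [f]
  have hinv : ∀ x, f x⁻¹ = -f x := fun x => by simp [f]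
  have hA : IsAlmostInvariant {x | 0 ≤ f x} := by
    intro g
    refine ((Set.finite_Icc (-|f g|) |f g|).preimage hf.injOn).subset fun x hx => ?_
    simp only [Set.mem_ofPred_eq, hmul, Set.mem_preimage, Set.mem_Icc] at hx ⊢
    rcases abs_cases (f g) with h | h <;> omega
  have hcover : ∀ B : Set G, B.Finite → (∀ x, f x ≠ 0 → x ∈ B ∨ x⁻¹ ∈ B) → False := by
    intro B hB h
    refine Set.infinite_univ (α := G) ((((Set.finite_singleton (0 : ℤ)).preimage hf.injOn).union
      (hB.union (hB.preimage inv_injective.injOn))).subset fun x _ => ?_)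
    by_cases hx : f x = 0
    · exact Or.inl hx
    · exact Or.inr (h x hx)
  rcases hG.finite_or_compl_finite _ hA with h | h
  · refine hcover _ h fun x hx => ?_
    simp only [Set.mem_ofPred_eq, hinv]
    omega
  · refine hcover _ h fun x hx => ?_
    simp only [Set.mem_compl_iff, Set.mem_ofPred_eq, hinv]
    omega

/-- A free group is a free product of infinite cyclic groups, so `G` would embed into one of these.
-/
theorem not_injective_freeGroup (hG : IsAlmostIndecomposable G) {α : Type*} [Finite α]
    (φ : G →* FreeGroup α) : ¬Function.Injective φ := by
  intro hφ
  let φ' : G →* CoprodI fun _ : α => FreeGroup Unit := freeGroupEquivCoprodI.toMonoidHom.comp φ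
  have hφ' : Function.Injective φ' := freeGroupEquivCoprodI.injective.comp hφ
  obtain ⟨j, a, h⟩ := CoprodI.exists_conj_mem_range hφ' hG
  obtain ⟨ψ, hψ, -⟩ := MonoidHom.exists_injective_lift_conj hφ' (CoprodI.of_injective j) h
  exact hG.not_injective_int (FreeGroup.mulEquivIntOfUnique.toMonoidHom.comp ψ)
    (FreeGroup.mulEquivIntOfUnique.injective.comp hψ)

theorem exists_conj_mem_range_inl_or_inr {A : Type*} {B : Type*} [Group A] [Group B]
    (hG : IsAlmostIndecomposable G) {φ : G →* Coprod A B} (hφ : Function.Injective φ) :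
    ∃ a : Coprod A B, (∀ x, a⁻¹ * φ x * a ∈ (Coprod.inl : A →* Coprod A B).range) ∨
      ∀ x, a⁻¹ * φ x * a ∈ (Coprod.inr : B →* Coprod A B).range := by
  let D := CoprodPair A B
  let f : Coprod A B →* CoprodI D :=
    Coprod.lift ((CoprodI.of (M := D) (i := false)).comp ⟨⟨ULift.up, rfl⟩, fun _ _ => rfl⟩)
      ((CoprodI.of (M := D) (i := true)).comp ⟨⟨ULift.up, rfl⟩, fun _ _ => rfl⟩)
  -- A left inverse of `f` suffices: it carries the conjugating element and the factors back.
  let g : CoprodI D →* Coprod A B := CoprodI.lift fun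
    | false => Coprod.inl.comp ⟨⟨ULift.down, rfl⟩, fun _ _ => rfl⟩
    | true => Coprod.inr.comp ⟨⟨ULift.down, rfl⟩, fun _ _ => rfl⟩
  have hgf : ∀ p, g (f p) = p := by
    have : g.comp f = MonoidHom.id _ := by
      apply Coprod.hom_ext <;> ext x <;> simp [f, g] <;> rfl
    exact fun p => DFunLike.congr_fun this p
  obtain ⟨b, a, h⟩ := CoprodI.exists_conj_mem_range (φ := f.comp φ)
    ((Function.LeftInverse.injective hgf).comp hφ) hG
  refine ⟨g a, ?_⟩
  have h' : ∀ x, ∃ y : D b, g (CoprodI.of y) = (g a)⁻¹ * φ x * g a := fun x => by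
    obtain ⟨y, hy⟩ := h x
    exact ⟨y, by rw [hy]; simp [hgf]⟩
  cases b with
  | false => exact Or.inl fun x => (h' x).elim fun y hy => ⟨ULift.down y, hy ▸ rfl⟩
  | true => exact Or.inr fun x => (h' x).elim fun y hy => ⟨ULift.down y, hy ▸ rfl⟩

/-- An infinite group without proper almost invariant subsets that embeds into
`K₁ * ⋯ * Kₙ * F` with `F` free is conjugate into some `Kⱼ`. -/
theorem exists_conj_factor {ι α : Type*} [Finite ι] [Finite α] {K : ι → Type*}
    [∀ i, Group (K i)] (hG : IsAlmostIndecomposable G)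
    {φ : G →* Coprod (CoprodI K) (FreeGroup α)} (hφ : Function.Injective φ) :
    ∃ (j : ι) (a : Coprod (CoprodI K) (FreeGroup α)) (ψ : G →* K j), Function.Injective ψ ∧
      ∀ x, Coprod.inl (CoprodI.of (ψ x)) = a⁻¹ * φ x * a := by
  obtain ⟨a, h | h⟩ := hG.exists_conj_mem_range_inl_or_inr hφ
  · obtain ⟨χ, hχ, hχ'⟩ := MonoidHom.exists_injective_lift_conj hφ Coprod.inl_injective h
    obtain ⟨j, b, hb⟩ := CoprodI.exists_conj_mem_range hχ hG
    obtain ⟨ψ, hψ, hψ'⟩ := MonoidHom.exists_injective_lift_conj hχ (CoprodI.of_injective j) hb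
    refine ⟨j, a * Coprod.inl b, ψ, hψ, fun x => ?_⟩
    rw [hψ', map_mul, map_mul, hχ', map_inv]
    simp only [mul_assoc, mul_inv_rev]
  · obtain ⟨χ, hχ, -⟩ := MonoidHom.exists_injective_lift_conj hφ Coprod.inr_injective h
    exact absurd hχ (hG.not_injective_freeGroup χ)

end IsAlmostIndecomposable

/-! ### Uniqueness of the decomposition. -/

section Uniqueness

variable {ι κ α β : Type*} {G : ι → Type*} {H : κ → Type*} [∀ i, Group (G i)] [∀ j, Group (H j)]

/-- If conjugation by an element of a free product carries the `i`-th factor into the `l`-th factor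
and this map factors through an injective map `θ`, then `l = i` and `θ` is an isomorphism. -/
theorem eq_and_nonempty_mulEquiv_of_conj {F K : Type*} [Group F] [Group K] {i l : ι}
    [Nontrivial (G i)] (c : Coprod (CoprodI G) F) (ψ : G i → K) (θ : K →* G l)
    (hθ : Function.Injective θ)
    (h : ∀ x, (Coprod.inl (CoprodI.of (θ (ψ x))) : Coprod (CoprodI G) F) =
      c⁻¹ * Coprod.inl (CoprodI.of x) * c) :
    l = i ∧ Nonempty (G i ≃* K) := by
  classical
  -- The retraction onto `G m` kills the other factors and `F`. Applied to `h`, it makes `θ ∘ ψ` an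
  -- inner automorphism if `l = i`, and forces `x = 1` otherwise.
  have retr : ∀ m, ∃ r : Coprod (CoprodI G) F →* G m,
      (∀ x : G m, r (Coprod.inl (CoprodI.of x)) = x) ∧
      ∀ (m' : ι) (x : G m'), m' ≠ m → r (Coprod.inl (CoprodI.of x)) = 1 := fun m =>
    ⟨Coprod.lift (CoprodI.lift (Pi.mulSingle m (MonoidHom.id (G m)))) 1, by simp,
      fun m' x hm => by simp [Pi.mulSingle_eq_of_ne hm]⟩
  by_cases hl : l = i
  · subst hl
    obtain ⟨r, hr, -⟩ := retr l
    have key : ∀ x, θ (ψ x) = (r c)⁻¹ * x * r c := fun x => by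
      have := congrArg r (h x)
      simpa [hr] using this
    refine ⟨rfl, ⟨(MulEquiv.ofBijective θ ⟨hθ, fun y => ⟨ψ (r c * y * (r c)⁻¹), ?_⟩⟩).symm⟩⟩
    rw [key]
    group
  · exfalso
    obtain ⟨r, hr, hr'⟩ := retr i
    obtain ⟨x, hx⟩ := exists_ne (1 : G i)
    have := congrArg r (h x)
    rw [hr' l _ hl, map_mul, map_mul, hr, map_inv] at this
    apply hx
    have h2 : x = r c * ((r c)⁻¹ * x * r c) * (r c)⁻¹ := by group
    rw [h2, ← this]
    group

/-- Uniqueness of the decomposition of a group as a free product of a free group and of groups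
without proper almost invariant subsets. -/
theorem exists_equiv_of_coprod_mulEquiv [Finite ι] [Finite κ] [Finite α] [Finite β]
    (hG : ∀ i, IsAlmostIndecomposable (G i)) (hH : ∀ j, IsAlmostIndecomposable (H j))
    (e : Coprod (CoprodI G) (FreeGroup α) ≃* Coprod (CoprodI H) (FreeGroup β)) :
    (∃ σ : ι ≃ κ, ∀ i, Nonempty (G i ≃* H (σ i))) ∧ Nonempty (α ≃ β) := by
  have hG' : ∀ i, Nontrivial (G i) := fun i => have := (hG i).infinite; inferInstance
  have hH' : ∀ j, Nontrivial (H j) := fun j => have := (hH j).infinite; inferInstance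
  choose f a ψ hψ hψ' using fun i => (hG i).exists_conj_factor
    (φ := e.toMonoidHom.comp (Coprod.inl.comp CoprodI.of))
    (e.injective.comp (Coprod.inl_injective.comp (CoprodI.of_injective i)))
  choose g b θ hθ hθ' using fun j => (hH j).exists_conj_factor
    (φ := e.symm.toMonoidHom.comp (Coprod.inl.comp CoprodI.of))
    (e.symm.injective.comp (Coprod.inl_injective.comp (CoprodI.of_injective j)))
  simp only [MonoidHom.comp_apply, MulEquiv.toMonoidHom_eq_coe, MonoidHom.coe_coe] at hψ' hθ'
  -- Going to `H (f i)` and back is conjugation by `e.symm (a i) * b (f i)`.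
  have hgf : ∀ i, g (f i) = i ∧ Nonempty (G i ≃* H (f i)) := fun i =>
    eq_and_nonempty_mulEquiv_of_conj (e.symm (a i) * b (f i)) (ψ i) (θ (f i)) (hθ (f i)) fun x => by
      rw [hθ', hψ']
      simp [mul_assoc]
  have hfg : ∀ j, f (g j) = j ∧ Nonempty (H j ≃* G (g j)) := fun j =>
    eq_and_nonempty_mulEquiv_of_conj (e (b j) * a (g j)) (θ j) (ψ (g j)) (hψ (g j)) fun x => by
      rw [hψ', hθ']
      simp [mul_assoc]
  refine ⟨⟨⟨f, g, fun i => (hgf i).1, fun j => (hfg j).1⟩, fun i => (hgf i).2⟩, ?_⟩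
  -- `Coprod.snd` kills the factors, and `e` carries them into conjugates of factors; so `e` and its
  -- inverse descend to the free quotients.
  let A : FreeGroup α →* FreeGroup β := Coprod.snd.comp (e.toMonoidHom.comp Coprod.inr)
  let B : FreeGroup β →* FreeGroup α := Coprod.snd.comp (e.symm.toMonoidHom.comp Coprod.inr)
  have hA : ∀ p, Coprod.snd (e p) = A (Coprod.snd p) := by
    have : Coprod.snd.comp e.toMonoidHom = A.comp Coprod.snd := by
      refine Coprod.hom_ext (CoprodI.ext_hom _ _ fun i => MonoidHom.ext fun x => ?_) rfl
      have h1 : e (Coprod.inl (CoprodI.of x)) =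
          a i * Coprod.inl (CoprodI.of (ψ i x)) * (a i)⁻¹ := by rw [hψ']; group
      simp [h1]
    exact DFunLike.congr_fun this
  have hB : ∀ p, Coprod.snd (e.symm p) = B (Coprod.snd p) := by
    have : Coprod.snd.comp e.symm.toMonoidHom = B.comp Coprod.snd := by
      refine Coprod.hom_ext (CoprodI.ext_hom _ _ fun i => MonoidHom.ext fun x => ?_) rfl
      have h1 : e.symm (Coprod.inl (CoprodI.of x)) =
          b i * Coprod.inl (CoprodI.of (θ i x)) * (b i)⁻¹ := by rw [hθ']; group
      simp [h1]
    exact DFunLike.congr_fun this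
  refine ⟨Equiv.ofFreeGroupEquiv (MonoidHom.toMulEquiv A B ?_ ?_)⟩
  · refine MonoidHom.ext fun x => ?_
    simp only [MonoidHom.comp_apply, MonoidHom.id_apply]
    change B (Coprod.snd (e (Coprod.inr x))) = x
    rw [← hB]
    simp
  · refine MonoidHom.ext fun x => ?_
    simp only [MonoidHom.comp_apply, MonoidHom.id_apply]
    change A (Coprod.snd (e.symm (Coprod.inr x))) = x
    rw [← hA]
    simp

end Uniqueness

theorem FreeProductDecomposition.value_eq {C : GroupFamily.{u}}
    (hends : ∀ (G : Type u) [Group G], C G → IsOneEnded G)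
    {ρ : C.RealFunction} (hρ : C.IsMultiplicativeInvariant ρ) {G H : Type u} [Group G] [Group H]
    (e : G ≃* H) (d : FreeProductDecomposition C G) (d' : FreeProductDecomposition C H) :
    d.value ρ = d'.value ρ := by
  obtain ⟨⟨σ, hσ⟩, ⟨τ⟩⟩ := exists_equiv_of_coprod_mulEquiv
    (fun i => (hends _ (d.factor_mem i)).isAlmostIndecomposable)
    (fun i => (hends _ (d'.factor_mem i)).isAlmostIndecomposable)
    ((d.equiv.symm.trans e).trans d'.equiv)
  have hn : d.n = d'.n := by simpa using Fintype.card_congr σ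
  have hr : d.r = d'.r := by simpa using Fintype.card_congr τ
  have hn' : (d.n : ℝ) = d'.n := congrArg _ hn
  rw [value, value, hn', hr, ← σ.sum_comp]
  congr 1
  exact Finset.sum_congr rfl fun i _ => hρ.eq_of_mulEquiv _ _ _ _ (hσ i)

/-! ### Spanning trees and labels along tree paths. -/

/-- A rooted spanning tree of the graph with vertices `X`, edges `E` and root `x₀`: every vertex
other than the root is joined by an edge to a vertex of smaller height. -/
structure RootedSpanningTree {X E : Type*} (src tgt : E → X) (x₀ : X) where
  parent : {x // x ≠ x₀} → E
  height : X → ℕ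
  parent_spec : ∀ x, (tgt (parent x) = x ∧ height (src (parent x)) < height x) ∨
    (src (parent x) = x ∧ height (tgt (parent x)) < height x)

namespace RootedSpanningTree

variable {X E : Type*} {src tgt : E → X} {x₀ : X}

/-- The height is the distance to the root, and the parent edge is the first edge of a shortest
path. -/
theorem nonempty_of_connected (h : ∀ S : Set X, x₀ ∈ S → (∀ e, src e ∈ S ↔ tgt e ∈ S) →
    ∀ x, x ∈ S) : Nonempty (RootedSpanningTree src tgt x₀) := by
  let Γ : SimpleGraph X := SimpleGraph.fromRel fun x y => ∃ e, src e = x ∧ tgt e = y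
  have hreach : ∀ x, Γ.Reachable x x₀ := by
    refine h {x | Γ.Reachable x x₀} (SimpleGraph.Reachable.refl _) fun e => ?_
    have he : Γ.Reachable (src e) (tgt e) := by
      by_cases hne : src e = tgt e
      · rw [hne]
      · exact SimpleGraph.Adj.reachable ((SimpleGraph.fromRel_adj _ _ _).2
          ⟨hne, Or.inl ⟨e, rfl, rfl⟩⟩)
    exact ⟨fun h => he.symm.trans h, fun h => he.trans h⟩
  have key : ∀ x : {x // x ≠ x₀}, ∃ e, (tgt e = x ∧ Γ.dist (src e) x₀ < Γ.dist x x₀) ∨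
      (src e = x ∧ Γ.dist (tgt e) x₀ < Γ.dist x x₀) := by
    rintro ⟨x, hx⟩
    obtain ⟨p, hp⟩ := (hreach x).exists_walk_length_eq_dist
    cases p with
    | nil => exact absurd rfl hx
    | @cons _ y _ hadj q =>
      have hlt : Γ.dist y x₀ < Γ.dist x x₀ := by
        have := SimpleGraph.dist_le q
        rw [SimpleGraph.Walk.length_cons] at hp
        omega
      rcases ((SimpleGraph.fromRel_adj _ _ _).1 hadj).2 with ⟨e, rfl, rfl⟩ | ⟨e, rfl, rfl⟩
      · exact ⟨e, Or.inr ⟨rfl, hlt⟩⟩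
      · exact ⟨e, Or.inl ⟨rfl, hlt⟩⟩
  choose par hpar using key
  exact ⟨⟨par, fun x => Γ.dist x x₀, hpar⟩⟩

variable (T : RootedSpanningTree src tgt x₀)

/-- An edge is the parent only of its higher endpoint. -/
theorem parent_injective : Function.Injective T.parent := by
  intro x y hxy
  have hx := T.parent_spec x
  have hy := T.parent_spec y
  rw [hxy] at hx
  rcases hx with ⟨h1, h2⟩ | ⟨h1, h2⟩ <;> rcases hy with ⟨h3, h4⟩ | ⟨h3, h4⟩
  · exact Subtype.ext (h1.symm.trans h3)
  · rw [h3] at h2; rw [h1] at h4; omega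
  · rw [h3] at h2; rw [h1] at h4; omega
  · exact Subtype.ext (h1.symm.trans h3)

theorem induction {motive : X → Prop} (root : motive x₀)
    (edge : ∀ e ∈ Set.range T.parent, motive (src e) ↔ motive (tgt e)) (x : X) : motive x := by
  induction h : T.height x using Nat.strong_induction_on generalizing x with
  | _ n ih =>
    by_cases hx : x = x₀
    · rwa [hx]
    · have he := edge _ ⟨⟨x, hx⟩, rfl⟩
      rcases T.parent_spec ⟨x, hx⟩ with ⟨h1, h2⟩ | ⟨h1, h2⟩
      · simp only at h1 h2
        rw [h1] at he
        exact he.1 (ih _ (h ▸ h2) _ rfl)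
      · simp only at h1 h2
        rw [h1] at he
        exact he.2 (ih _ (h ▸ h2) _ rfl)

open Classical in
/-- The product of the labels along the path in the tree from the root to a vertex. -/
noncomputable def transport {P : Type*} [Group P] (lab : E → P) (x : X) : P :=
  if hx : x = x₀ then 1
  -- The height tests find the end nearer to the root and ensure termination; by `parent_spec` the
  -- last branch never occurs.
  else if _ : T.height (src (T.parent ⟨x, hx⟩)) < T.height x then
    lab (T.parent ⟨x, hx⟩) * transport lab (src (T.parent ⟨x, hx⟩))
  else if _ : T.height (tgt (T.parent ⟨x, hx⟩)) < T.height x then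
    (lab (T.parent ⟨x, hx⟩))⁻¹ * transport lab (tgt (T.parent ⟨x, hx⟩))
  else 1
termination_by T.height x

variable {P : Type*} [Group P] (lab : E → P)

theorem transport_root : T.transport lab x₀ = 1 := by
  rw [transport]
  simp

theorem transport_tgt {e : E} (he : e ∈ Set.range T.parent) :
    T.transport lab (tgt e) = lab e * T.transport lab (src e) := by
  obtain ⟨⟨x, hx⟩, rfl⟩ := he
  rcases T.parent_spec ⟨x, hx⟩ with ⟨h1, h2⟩ | ⟨h1, h2⟩
  · simp only at h1 h2
    conv_lhs => rw [h1, transport]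
    rw [dif_neg hx, dif_pos h2]
  · simp only at h1 h2
    conv_rhs => rw [h1, transport]
    rw [dif_neg hx, dif_neg (by rw [h1]; exact lt_irrefl _), dif_pos h2, mul_inv_cancel_left]

end RootedSpanningTree

/-- Induction for `G₁ * ⋯ * Gₙ * F`. -/
theorem Monoid.Coprod.factor_induction {ι α : Type*} {G : ι → Type*} [∀ i, Group (G i)]
    {motive : Coprod (CoprodI G) (FreeGroup α) → Prop}
    (factor : ∀ (i : ι) (k : G i), motive (Coprod.inl (CoprodI.of k)))
    (gen : ∀ a : α, motive (Coprod.inr (FreeGroup.of a)))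
    (one : motive 1) (mul : ∀ g h, motive g → motive h → motive (g * h))
    (inv : ∀ g, motive g → motive g⁻¹) (g : Coprod (CoprodI G) (FreeGroup α)) : motive g := by
  induction g using Coprod.induction_on with
  | inl x =>
    induction x using CoprodI.induction_on with
    | one => simpa using one
    | of i k => exact factor i k
    | mul x y hx hy => simpa using mul _ _ hx hy
  | inr x =>
    induction x using FreeGroup.induction_on with
    | C1 => simpa using one
    | of a => exact gen a
    | inv_of a h => simpa using inv _ h
    | mul x y hx hy => simpa using mul _ _ hx hy
  | mul g h hg hh => exact mul g h hg hh

/-- The action on `X × Q` given by an action on `X` and a cocycle with values in `Q`. -/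
def cocyclePerm {K X Q : Type*} [Group K] [Group Q] (s : K → X → X) (hs1 : ∀ x, s 1 x = x)
    (hs : ∀ k k' x, s (k * k') x = s k (s k' x)) (c : K → X → Q)
    (hc : ∀ k k' x, c (k * k') x = c k (s k' x) * c k' x) : K →* Equiv.Perm (X × Q) :=
  MonoidHom.toHomPerm
    { toFun := fun k p => (s k p.1, c k p.1 * p.2)
      map_one' := by
        funext p
        have : c 1 p.1 = 1 := by simpa [hs1] using hc 1 1 p.1
        simp [hs1, this]
        rfl
      map_mul' := fun k k' => by
        funext p
        simp [hs, hc, mul_assoc]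
        rfl }

/-! ### The Kurosh subgroup theorem by a cocycle on the action. -/

section Kurosh

variable {ι : Type*} {α : Type*} {G : ι → Type*} [∀ i, Group (G i)]

/-- The inclusion of a factor into `G₁ * ⋯ * Gₙ * F`. -/
abbrev factorHom (G : ι → Type*) [∀ i, Group (G i)] (α : Type*) (i : ι) :
    G i →* Coprod (CoprodI G) (FreeGroup α) :=
  Coprod.inl.comp CoprodI.of

/-- A choice, for each factor `G i`, of a base point in each `G i`-orbit on `X`, and of elements of
`G i` carrying base points to the points of their orbits. -/
structure OrbitTransversal (G : ι → Type*) [∀ i, Group (G i)] (α X : Type*)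
    [MulAction (Coprod (CoprodI G) (FreeGroup α)) X] where
  base : ι → X → X
  elt : ∀ i, X → G i
  elt_smul : ∀ i x, factorHom G α i (elt i x) • base i x = x
  base_smul : ∀ i (k : G i) x, base i (factorHom G α i k • x) = base i x
  elt_eq_one : ∀ i x, base i x = x → elt i x = 1

variable {X : Type*} [MulAction (Coprod (CoprodI G) (FreeGroup α)) X]

theorem OrbitTransversal.nonempty : Nonempty (OrbitTransversal G α X) := by
  classical
  let r : ι → Setoid X := fun i =>
    { r := fun x y => ∃ k : G i, factorHom G α i k • x = y
      iseqv := ⟨fun x => ⟨1, by simp⟩, fun {x y} ⟨k, hk⟩ => ⟨k⁻¹, by rw [← hk]; simp⟩,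
        fun {x y z} ⟨k, hk⟩ ⟨k', hk'⟩ => ⟨k' * k, by rw [map_mul, mul_smul, hk, hk']⟩⟩ }
  let base : ι → X → X := fun i x => (Quotient.mk (r i) x).out
  have hb : ∀ i x, ∃ k : G i, factorHom G α i k • base i x = x := fun i x =>
    Quotient.exact (s := r i) (Quotient.out_eq _)
  choose k hk using hb
  refine ⟨⟨base, fun i x => if base i x = x then 1 else k i x, fun i x => ?_, fun i g x => ?_,
    fun i x h => if_pos h⟩⟩
  · split_ifs with h
    · rw [map_one, one_smul, h]
    · exact hk i x
  · exact congrArg Quotient.out (Quotient.sound (s := r i) ⟨g⁻¹, by simp⟩)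

namespace OrbitTransversal

variable (T : OrbitTransversal G α X)

theorem base_base (i : ι) (x : X) : T.base i (T.base i x) = T.base i x := by
  conv_rhs => rw [← T.elt_smul i x]
  rw [T.base_smul]

/-- The index set of the factors of a point stabilizer: the orbits of the factors `G i`. -/
abbrev Orbit : Type _ := Σ i, {o : X // T.base i o = o}

/-- The stabilizer in `G i` of the base point of an orbit. -/
def orbitStabilizer (a : T.Orbit) : Subgroup (G a.1) :=
  (MulAction.stabilizer (Coprod (CoprodI G) (FreeGroup α)) a.2.1).comap (factorHom G α a.1)

theorem mem_orbitStabilizer {a : T.Orbit} {k : G a.1} :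
    k ∈ T.orbitStabilizer a ↔ factorHom G α a.1 k • a.2.1 = a.2.1 := Iff.rfl

/-- The edges joining the points of `X` to the base points of their orbits, and the edges given by
the free generators. -/
abbrev Edge : Type _ := {p : ι × X // T.base p.1 p.2 ≠ p.2} ⊕ α × X

/-- The source of an edge. -/
def src : T.Edge → X
  | .inl p => T.base p.1.1 p.1.2
  | .inr p => p.2

/-- The target of an edge. -/
def tgt : T.Edge → X
  | .inl p => p.1.2
  | .inr p => (Coprod.inr (FreeGroup.of p.1) : Coprod (CoprodI G) (FreeGroup α)) • p.2

/-- The label of an edge, a group element that carries its source to its target. -/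
def label : T.Edge → Coprod (CoprodI G) (FreeGroup α)
  | .inl p => factorHom G α p.1.1 (T.elt p.1.1 p.1.2)
  | .inr p => Coprod.inr (FreeGroup.of p.1)

theorem label_smul (e : T.Edge) : T.label e • T.src e = T.tgt e := by
  rcases e with p | p
  · exact T.elt_smul _ _
  · rfl

theorem nonempty_rootedSpanningTree [MulAction.IsPretransitive
    (Coprod (CoprodI G) (FreeGroup α)) X] (x₀ : X) :
    Nonempty (RootedSpanningTree T.src T.tgt x₀) := by
  refine RootedSpanningTree.nonempty_of_connected fun S h₀ hS x => ?_
  have key : ∀ (g : Coprod (CoprodI G) (FreeGroup α)) y, y ∈ S ↔ g • y ∈ S := by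
    intro g
    induction g using Coprod.factor_induction with
    | factor i k =>
      have hb : ∀ y, y ∈ S ↔ T.base i y ∈ S := fun y => by
        by_cases h : T.base i y = y
        · rw [h]
        · exact (hS (.inl ⟨(i, y), h⟩)).symm
      intro y
      have := T.base_smul i k y
      rw [MonoidHom.comp_apply] at this
      rw [hb, hb (_ • y), this]
    | gen a => exact fun y => hS (.inr (a, y))
    | one => simp
    | mul g h hg hh => exact fun y => by rw [mul_smul, ← hg, ← hh]
    | inv g hg => exact fun y => by rw [hg (g⁻¹ • y), smul_inv_smul]
  obtain ⟨g, rfl⟩ := MulAction.exists_smul_eq (Coprod (CoprodI G) (FreeGroup α)) x₀ x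
  exact (key g x₀).1 h₀

variable {x₀ : X} (R : RootedSpanningTree T.src T.tgt x₀)

/-- The free product of the orbit stabilizers and of the free group on the edges outside a
spanning tree. -/
abbrev KuroshProduct : Type _ :=
  Coprod (CoprodI fun a : T.Orbit => T.orbitStabilizer a)
    (FreeGroup {e : T.Edge // e ∉ Set.range R.parent})

/-- The inclusion of an orbit stabilizer into the Kurosh product. -/
abbrev orbitHom (a : T.Orbit) : T.orbitStabilizer a →* T.KuroshProduct R :=
  factorHom (fun a : T.Orbit => T.orbitStabilizer a) _ a

open Classical in
/-- The element of the Kurosh product given by an edge, trivial for edges of the tree. -/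
noncomputable def edgeElt (e : T.Edge) : T.KuroshProduct R :=
  if h : e ∈ Set.range R.parent then 1 else Coprod.inr (FreeGroup.of ⟨e, h⟩)

open Classical in
/-- The element of the Kurosh product given by the edge from the base point of the `G i`-orbit of
`x` to `x`. -/
noncomputable def spokeElt (i : ι) (x : X) : T.KuroshProduct R :=
  if h : T.base i x = x then 1 else T.edgeElt R (.inl ⟨(i, x), h⟩)

open Classical in
/-- An element of an orbit stabilizer as an element of the Kurosh product, extended by `1`. -/
noncomputable def stabElt (i : ι) (o : X) (k : G i) : T.KuroshProduct R :=
  if h : ∃ ho : T.base i o = o, k ∈ T.orbitStabilizer ⟨i, o, ho⟩ then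
    T.orbitHom R ⟨i, o, h.choose⟩ ⟨k, h.choose_spec⟩
  else 1

theorem stabElt_of_mem {i : ι} {o : X} (ho : T.base i o = o) {k : G i}
    (hk : k ∈ T.orbitStabilizer ⟨i, o, ho⟩) :
    T.stabElt R i o k = T.orbitHom R ⟨i, o, ho⟩ ⟨k, hk⟩ :=
  dif_pos ⟨ho, hk⟩

theorem stabElt_mul {i : ι} {o : X} (ho : T.base i o = o) {k k' : G i}
    (hk : k ∈ T.orbitStabilizer ⟨i, o, ho⟩) (hk' : k' ∈ T.orbitStabilizer ⟨i, o, ho⟩) :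
    T.stabElt R i o (k * k') = T.stabElt R i o k * T.stabElt R i o k' := by
  rw [T.stabElt_of_mem R ho hk, T.stabElt_of_mem R ho hk',
    T.stabElt_of_mem R ho (mul_mem hk hk'), ← map_mul]
  rfl

theorem stabElt_one {i : ι} {o : X} (ho : T.base i o = o) : T.stabElt R i o 1 = 1 := by
  have := T.stabElt_mul R ho (one_mem _) (one_mem _)
  rwa [mul_one, left_eq_mul] at this

/-- The return element of `k` at `x`, which fixes the base point of the orbit. -/
def returnElt (i : ι) (k : G i) (x : X) : G i :=
  (T.elt i (factorHom G α i k • x))⁻¹ * k * T.elt i x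

theorem returnElt_mem (i : ι) (k : G i) (x : X) :
    T.returnElt i k x ∈ T.orbitStabilizer ⟨i, T.base i x, T.base_base i x⟩ := by
  have h := T.elt_smul i (factorHom G α i k • x)
  rw [T.base_smul] at h
  rw [mem_orbitStabilizer, returnElt, map_mul, map_mul, mul_smul, mul_smul]
  dsimp only
  rw [T.elt_smul, map_inv, inv_smul_eq_iff, h]

theorem returnElt_mul (i : ι) (k k' : G i) (x : X) : T.returnElt i (k * k') x =
    T.returnElt i k (factorHom G α i k' • x) * T.returnElt i k' x := by
  simp only [returnElt, map_mul, mul_smul]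
  group

/-- The cocycle of a factor with values in the Kurosh product. -/
noncomputable def factorCocycle (i : ι) (k : G i) (x : X) : T.KuroshProduct R :=
  -- Read from right to left: back along the spoke of `x` to the base point, a loop there, and out
  -- along the spoke of `k • x`.
  T.spokeElt R i (factorHom G α i k • x) * T.stabElt R i (T.base i x) (T.returnElt i k x) *
    (T.spokeElt R i x)⁻¹

theorem factorCocycle_mul (i : ι) (k k' : G i) (x : X) : T.factorCocycle R i (k * k') x =
    T.factorCocycle R i k (factorHom G α i k' • x) * T.factorCocycle R i k' x := by
  have h : T.returnElt i k (factorHom G α i k' • x) ∈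
      T.orbitStabilizer ⟨i, T.base i x, T.base_base i x⟩ := by
    have h := T.returnElt_mem i k (factorHom G α i k' • x)
    rw [mem_orbitStabilizer] at h ⊢
    simpa only [T.base_smul] using h
  simp only [factorCocycle, T.base_smul, T.returnElt_mul,
    T.stabElt_mul R (T.base_base i x) h (T.returnElt_mem i k' x), map_mul, mul_smul]
  group

/-- The action of `G₁ * ⋯ * Gₙ * F` on `X × Q`, where `Q` is the Kurosh product. -/
noncomputable def kuroshPerm :
    Coprod (CoprodI G) (FreeGroup α) →* Equiv.Perm (X × T.KuroshProduct R) :=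
  Coprod.lift
    (CoprodI.lift fun i => cocyclePerm (fun k x => factorHom G α i k • x)
      (fun x => by simp) (fun k k' x => by rw [map_mul, mul_smul]) (T.factorCocycle R i)
      (T.factorCocycle_mul R i))
    (FreeGroup.lift fun a =>
      { toFun := fun p => ((Coprod.inr (FreeGroup.of a) :
          Coprod (CoprodI G) (FreeGroup α)) • p.1, T.edgeElt R (.inr (a, p.1)) * p.2)
        invFun := fun p => ((Coprod.inr (FreeGroup.of a) :
          Coprod (CoprodI G) (FreeGroup α))⁻¹ • p.1,
          (T.edgeElt R (.inr (a, (Coprod.inr (FreeGroup.of a) :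
            Coprod (CoprodI G) (FreeGroup α))⁻¹ • p.1)))⁻¹ * p.2)
        left_inv := fun p => by simp
        right_inv := fun p => by simp })

/-- The cocycle of `G₁ * ⋯ * Gₙ * F` with values in the Kurosh product. -/
noncomputable def cocycle (g : Coprod (CoprodI G) (FreeGroup α)) (x : X) : T.KuroshProduct R :=
  (T.kuroshPerm R g (x, 1)).2

/-- The generators act on the second coordinate by left multiplications, so the value at `1`
determines the action. -/
theorem kuroshPerm_apply (g : Coprod (CoprodI G) (FreeGroup α)) (x : X)
    (q : T.KuroshProduct R) : T.kuroshPerm R g (x, q) = (g • x, T.cocycle R g x * q) := by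
  have key : ∀ g : Coprod (CoprodI G) (FreeGroup α), ∀ x, ∃ z, ∀ q,
      T.kuroshPerm R g (x, q) = (g • x, z * q) := by
    intro g
    induction g using Coprod.factor_induction with
    | factor i k => exact fun x => ⟨T.factorCocycle R i k x, fun q => rfl⟩
    | gen a => exact fun x => ⟨T.edgeElt R (.inr (a, x)), fun q => by simp [kuroshPerm]⟩
    | one => exact fun x => ⟨1, fun q => by simp⟩
    | mul g h hg hh =>
      intro x
      obtain ⟨z, hz⟩ := hh x
      obtain ⟨z', hz'⟩ := hg (h • x)
      exact ⟨z' * z, fun q => by rw [map_mul, Equiv.Perm.mul_apply, hz, hz', mul_smul, mul_assoc]⟩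
    | inv g hg =>
      intro x
      obtain ⟨z, hz⟩ := hg (g⁻¹ • x)
      exact ⟨z⁻¹, fun q => by rw [map_inv, Equiv.Perm.inv_eq_iff_eq, hz]; simp⟩
  obtain ⟨z, hz⟩ := key g x
  rw [cocycle, hz, hz, mul_one]

theorem cocycle_mul (g h : Coprod (CoprodI G) (FreeGroup α)) (x : X) :
    T.cocycle R (g * h) x = T.cocycle R g (h • x) * T.cocycle R h x := by
  have := T.kuroshPerm_apply R (g * h) x 1
  rw [map_mul, Equiv.Perm.mul_apply, kuroshPerm_apply, kuroshPerm_apply] at this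
  simpa using (congrArg Prod.snd this).symm

theorem cocycle_one (x : X) : T.cocycle R 1 x = 1 := by
  simpa using T.cocycle_mul R 1 1 x

theorem cocycle_inv (g : Coprod (CoprodI G) (FreeGroup α)) (x : X) :
    T.cocycle R g⁻¹ x = (T.cocycle R g (g⁻¹ • x))⁻¹ := by
  rw [eq_inv_iff_mul_eq_one]
  have := T.cocycle_mul R g⁻¹ g (g⁻¹ • x)
  rw [inv_mul_cancel, cocycle_one, smul_inv_smul] at this
  exact this.symm

theorem cocycle_factor (i : ι) (k : G i) (x : X) :
    T.cocycle R (factorHom G α i k) x = T.factorCocycle R i k x :=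
  mul_one _

theorem cocycle_gen (a : α) (x : X) :
    T.cocycle R (Coprod.inr (FreeGroup.of a)) x = T.edgeElt R (.inr (a, x)) := by
  simp [cocycle, kuroshPerm]

theorem spokeElt_of_base {i : ι} {x : X} (h : T.base i x = x) : T.spokeElt R i x = 1 :=
  dif_pos h

/-- The normalization `elt_eq_one` makes the return element along a spoke trivial, so only the edge
element remains. -/
theorem cocycle_label (e : T.Edge) : T.cocycle R (T.label e) (T.src e) = T.edgeElt R e := by
  rcases e with ⟨⟨i, x⟩, hx⟩ | ⟨a, x⟩
  · have h1 : T.returnElt i (T.elt i x) (T.base i x) = 1 := by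
      rw [returnElt, T.elt_smul, T.elt_eq_one i (T.base i x) (T.base_base i x)]
      simp
    simp only [label, src]
    rw [cocycle_factor, factorCocycle, h1, T.base_base, T.stabElt_one R (T.base_base i x),
      T.spokeElt_of_base R (T.base_base i x), T.elt_smul, spokeElt, dif_neg hx]
    simp
  · exact T.cocycle_gen R a x

theorem cocycle_of_mem (a : T.Orbit) (k : T.orbitStabilizer a) :
    T.cocycle R (factorHom G α a.1 k) a.2.1 = T.orbitHom R a k := by
  obtain ⟨i, o, ho⟩ := a
  have hk : factorHom G α i k • o = o := k.2
  have h1 : T.returnElt i k o = k := by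
    rw [returnElt, hk, T.elt_eq_one i o ho]
    simp
  simp only
  rw [cocycle_factor, factorCocycle, h1, hk, ho, T.spokeElt_of_base R ho,
    T.stabElt_of_mem R ho k.2]
  simp

theorem transport_smul (x : X) : R.transport T.label x • x₀ = x := by
  induction x using R.induction with
  | root => rw [R.transport_root, one_smul]
  | edge e he =>
    rw [R.transport_tgt T.label he, mul_smul, ← T.label_smul e, smul_left_cancel_iff]

theorem cocycle_transport (x : X) : T.cocycle R (R.transport T.label x) x₀ = 1 := by
  induction x using R.induction with
  | root => rw [R.transport_root, cocycle_one]
  | edge e he =>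
    rw [R.transport_tgt T.label he, cocycle_mul, T.transport_smul R, cocycle_label, edgeElt,
      dif_pos he, one_mul]

/-- The values of the cocycle on return paths through the spanning tree. -/
theorem cocycle_conj_transport (g : Coprod (CoprodI G) (FreeGroup α)) (x y : X)
    (h : g • x = y) :
    T.cocycle R ((R.transport T.label y)⁻¹ * g * R.transport T.label x) x₀ =
      T.cocycle R g x := by
  have h2 : (R.transport T.label y)⁻¹ • y = x₀ := by
    rw [inv_smul_eq_iff, T.transport_smul R]
  rw [cocycle_mul, cocycle_mul, T.transport_smul R, cocycle_transport, cocycle_inv, h, h2,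
    cocycle_transport]
  simp

/-- The map from the Kurosh product back to `G₁ * ⋯ * Gₙ * F`. -/
noncomputable def kuroshInclusion :
    T.KuroshProduct R →* Coprod (CoprodI G) (FreeGroup α) :=
  Coprod.lift
    (CoprodI.lift fun a => (MulAut.conj (R.transport T.label a.2.1)⁻¹).toMonoidHom.comp
      ((factorHom G α a.1).comp (T.orbitStabilizer a).subtype))
    (FreeGroup.lift fun e =>
      (R.transport T.label (T.tgt e))⁻¹ * T.label e * R.transport T.label (T.src e))

theorem kuroshInclusion_edgeElt (e : T.Edge) : T.kuroshInclusion R (T.edgeElt R e) =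
    (R.transport T.label (T.tgt e))⁻¹ * T.label e * R.transport T.label (T.src e) := by
  rw [edgeElt]
  split_ifs with h
  · rw [R.transport_tgt T.label h]
    simp [mul_assoc]
  · simp [kuroshInclusion]

theorem kuroshInclusion_spokeElt (i : ι) (x : X) : T.kuroshInclusion R (T.spokeElt R i x) =
    (R.transport T.label x)⁻¹ * factorHom G α i (T.elt i x) *
      R.transport T.label (T.base i x) := by
  rw [spokeElt]
  split_ifs with h
  · rw [T.elt_eq_one i x h, h]
    simp
  · exact T.kuroshInclusion_edgeElt R _

theorem kuroshInclusion_stabElt {i : ι} {o : X} (ho : T.base i o = o) {k : G i}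
    (hk : k ∈ T.orbitStabilizer ⟨i, o, ho⟩) : T.kuroshInclusion R (T.stabElt R i o k) =
    (R.transport T.label o)⁻¹ * factorHom G α i k * R.transport T.label o := by
  rw [T.stabElt_of_mem R ho hk]
  simp [kuroshInclusion]

/-- On the stabilizer of `x₀` the composite is a conjugation, which gives injectivity in
`stabilizerEquiv`. -/
theorem kuroshInclusion_cocycle (g : Coprod (CoprodI G) (FreeGroup α)) :
    ∀ x, T.kuroshInclusion R (T.cocycle R g x) =
      (R.transport T.label (g • x))⁻¹ * g * R.transport T.label x := by
  induction g using Coprod.factor_induction with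
  | factor i k =>
    intro x
    have := T.cocycle_factor R i k x
    rw [MonoidHom.comp_apply] at this
    rw [this, factorCocycle, map_mul, map_mul, map_inv,
      kuroshInclusion_spokeElt, kuroshInclusion_spokeElt,
      T.kuroshInclusion_stabElt R (T.base_base i x) (T.returnElt_mem i k x), T.base_smul,
      returnElt, map_mul, map_mul, map_inv]
    simp only [MonoidHom.comp_apply]
    group
  | gen a =>
    intro x
    rw [cocycle_gen, kuroshInclusion_edgeElt]
    rfl
  | one => intro x; simp [cocycle_one]
  | mul g h hg hh =>
    intro x
    rw [cocycle_mul, map_mul, hg, hh, mul_smul]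
    group
  | inv g hg =>
    intro x
    rw [cocycle_inv, map_inv, hg, smul_inv_smul]
    group

/-- **Kurosh subgroup theorem**: a point stabilizer of an action of `G₁ * ⋯ * Gₙ * F` is the free
product of the stabilizers in the `G i` of the base points of the `G i`-orbits and of a free group
on the edges outside a spanning tree. -/
noncomputable def stabilizerEquiv :
    MulAction.stabilizer (Coprod (CoprodI G) (FreeGroup α)) x₀ ≃* T.KuroshProduct R :=
  MulEquiv.ofBijective
    (MonoidHom.mk' (fun h : MulAction.stabilizer (Coprod (CoprodI G) (FreeGroup α)) x₀ =>
      T.cocycle R h x₀) fun g h => by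
      rw [Subgroup.coe_mul, cocycle_mul, MulAction.mem_stabilizer_iff.1 h.2])
    (by
      refine ⟨fun g h hgh => ?_, ?_⟩
      · have := congrArg (T.kuroshInclusion R) hgh
        simp only [MonoidHom.mk'_apply, kuroshInclusion_cocycle] at this
        rw [MulAction.mem_stabilizer_iff.1 g.2, MulAction.mem_stabilizer_iff.1 h.2] at this
        exact Subtype.ext (mul_left_cancel (mul_right_cancel this))
      -- Surjectivity: each generator is the value on a loop that goes out through the tree, crosses
      -- one edge or applies one stabilizer element, and returns.
      · have conj_mem : ∀ (g : Coprod (CoprodI G) (FreeGroup α)) (x y : X), g • x = y →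
            (R.transport T.label y)⁻¹ * g * R.transport T.label x ∈
              MulAction.stabilizer (Coprod (CoprodI G) (FreeGroup α)) x₀ := by
          intro g x y h
          rw [MulAction.mem_stabilizer_iff, mul_smul, mul_smul, T.transport_smul R, h,
            inv_smul_eq_iff, T.transport_smul R]
        intro q
        induction q using Coprod.factor_induction with
        | factor a k =>
          exact ⟨⟨_, conj_mem (factorHom G α a.1 k) a.2.1 a.2.1 k.2⟩,
            (T.cocycle_conj_transport R _ _ _ k.2).trans (T.cocycle_of_mem R a k)⟩
        | gen e =>
          refine ⟨⟨_, conj_mem (T.label e) (T.src e) (T.tgt e) (T.label_smul e)⟩,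
            (T.cocycle_conj_transport R _ _ _ (T.label_smul e)).trans ?_⟩
          rw [cocycle_label, edgeElt, dif_neg e.2]
        | one => exact ⟨1, map_one _⟩
        | mul g h hg hh =>
          obtain ⟨x, rfl⟩ := hg
          obtain ⟨y, rfl⟩ := hh
          exact ⟨x * y, map_mul _ _ _⟩
        | inv g hg =>
          obtain ⟨x, rfl⟩ := hg
          exact ⟨x⁻¹, map_inv _ _⟩)

end OrbitTransversal

end Kurosh

/-! ### Counting orbits and edges. -/

namespace OrbitTransversal

variable {ι α : Type*} {G : ι → Type*} [∀ i, Group (G i)] {X : Type*}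
  [MulAction (Coprod (CoprodI G) (FreeGroup α)) X] (T : OrbitTransversal G α X)

theorem index_orbitStabilizer (a : T.Orbit) :
    (T.orbitStabilizer a).index = Nat.card {x // T.base a.1 x = a.2.1} := by
  let _ : MulAction (G a.1) X := MulAction.compHom X (factorHom G α a.1)
  have h : T.orbitStabilizer a = MulAction.stabilizer (G a.1) a.2.1 := rfl
  rw [h, MulAction.index_stabilizer, ← Nat.card_coe_set_eq]
  refine Nat.card_congr (Equiv.subtypeEquivRight fun x => ⟨?_, fun hx => ?_⟩)
  · rintro ⟨k, rfl⟩
    exact (T.base_smul a.1 k a.2.1).trans a.2.2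
  · exact ⟨T.elt a.1 x, by rw [← hx]; exact T.elt_smul a.1 x⟩

theorem finiteIndex_orbitStabilizer [Finite X] (a : T.Orbit) :
    (T.orbitStabilizer a).FiniteIndex := by
  refine ⟨?_⟩
  rw [index_orbitStabilizer]
  have : Nonempty {x // T.base a.1 x = a.2.1} := ⟨⟨a.2.1, a.2.2⟩⟩
  exact Nat.card_pos.ne'

/-- For each `i` the index of a stabilizer is the length of its orbit, and the orbits partition `X`.
-/
theorem sum_index_orbitStabilizer [Fintype ι] [Finite X] [Fintype T.Orbit] (f : ι → ℝ) :
    ∑ a : T.Orbit, ((T.orbitStabilizer a).index : ℝ) * f a.1 = Nat.card X * ∑ i, f i := by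
  classical
  have := Fintype.ofFinite X
  have h : ∀ i, ∑ o : {o : X // T.base i o = o}, (T.orbitStabilizer ⟨i, o⟩).index = Nat.card X := by
    intro i
    simp only [index_orbitStabilizer]
    rw [← Nat.card_sigma]
    exact Nat.card_congr
      { toFun := fun p => p.2.1
        invFun := fun x => ⟨⟨T.base i x, T.base_base i x⟩, x, rfl⟩
        left_inv := by
          rintro ⟨⟨o, ho⟩, x, hx⟩
          dsimp only at hx
          subst hx
          rfl
        right_inv := fun x => rfl }
  have h2 := Fintype.sum_sigma fun a : T.Orbit => ((T.orbitStabilizer a).index : ℝ) * f a.1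
  have h3 : ∀ i, ∑ o : {o : X // T.base i o = o},
      ((T.orbitStabilizer ⟨i, o⟩).index : ℝ) * f i = Nat.card X * f i := fun i => by
    rw [← Finset.sum_mul, ← Nat.cast_sum, h]
  rw [Finset.mul_sum, ← Finset.sum_congr rfl fun i _ => h3 i, ← h2]
  congr!

/-- The tree has one edge per non-root point, and the spokes are the pairs `(i, x)` with `x` not a
base point. The identity is arranged without subtraction in `ℕ`. -/
theorem card_edge_add [Finite ι] [Finite α] [Finite X] {x₀ : X}
    (R : RootedSpanningTree T.src T.tgt x₀) :
    Nat.card {e : T.Edge // e ∉ Set.range R.parent} + Nat.card X + Nat.card T.Orbit =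
      Nat.card ι * Nat.card X + Nat.card α * Nat.card X + 1 := by
  classical
  have hpar : Nat.card {e : T.Edge // e ∈ Set.range R.parent} + 1 = Nat.card X := by
    rw [Nat.card_congr (Equiv.ofInjective _ R.parent_injective).symm, ← Finite.card_option]
    exact Nat.card_congr (Equiv.optionSubtypeNe x₀)
  have hedge : Nat.card {e : T.Edge // e ∈ Set.range R.parent} +
      Nat.card {e : T.Edge // e ∉ Set.range R.parent} = Nat.card T.Edge := by
    rw [← Nat.card_sum]
    exact Nat.card_congr (Equiv.sumCompl _)
  have horb : Nat.card T.Orbit + Nat.card {p : ι × X // T.base p.1 p.2 ≠ p.2} =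
      Nat.card ι * Nat.card X := by
    rw [← Nat.card_prod, ← Nat.card_congr (Equiv.sumCompl fun p : ι × X => T.base p.1 p.2 = p.2),
      Nat.card_sum]
    congr 1
    exact Nat.card_congr
      { toFun := fun a => ⟨(a.1, a.2.1), a.2.2⟩
        invFun := fun p => ⟨p.1.1, p.1.2, p.2⟩
        left_inv := fun _ => rfl
        right_inv := fun _ => rfl }
  have hsum : Nat.card T.Edge = Nat.card {p : ι × X // T.base p.1 p.2 ≠ p.2} +
      Nat.card α * Nat.card X := by
    rw [Nat.card_sum, Nat.card_prod]
  omega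

end OrbitTransversal

/-! ### Finite-index subgroups and the main theorem. -/

/-- Reindexing a free product. -/
theorem Monoid.CoprodI.nonempty_mulEquiv_reindex {ι κ : Type*} {G : κ → Type*}
    [∀ i, Group (G i)] (e : ι ≃ κ) : Nonempty (CoprodI G ≃* CoprodI fun i => G (e i)) := by
  -- `e (e.symm a)` is only propositionally equal to `a`, so letters change factor by homomorphisms
  -- that are heterogeneously the identity.
  have castHom : ∀ {a b : κ}, a = b → ∃ f : G a →* G b, ∀ x, HEq (f x) x := by
    rintro a _ rfl
    exact ⟨MonoidHom.id _, fun x => HEq.rfl⟩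
  choose c hc using fun a => castHom (e.apply_symm_apply a).symm
  have of_heq : ∀ {a b : κ}, a = b → ∀ (x : G a) (y : G b), HEq x y →
      (of x : CoprodI G) = of y := by
    rintro a _ rfl x _ ⟨⟩
    rfl
  have of_heq' : ∀ {a b : ι}, a = b → ∀ (x : G (e a)) (y : G (e b)), HEq x y →
      (of (M := fun i => G (e i)) x) = of (M := fun i => G (e i)) y := by
    rintro a _ rfl x _ ⟨⟩
    rfl
  refine ⟨MonoidHom.toMulEquiv
    (lift fun a => (of (M := fun i => G (e i)) (i := e.symm a)).comp (c a))
    (lift fun i => of (i := e i)) ?_ ?_⟩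
  · refine ext_hom _ _ fun a => MonoidHom.ext fun x => ?_
    simp only [MonoidHom.comp_apply, lift_of, MonoidHom.id_apply]
    exact of_heq (e.apply_symm_apply a) _ _ (hc a x)
  · refine ext_hom _ _ fun i => MonoidHom.ext fun x => ?_
    simp only [MonoidHom.comp_apply, lift_of, MonoidHom.id_apply]
    exact of_heq' (e.symm_apply_apply i) _ _ (hc (e i) x)

/-- A finite-index subgroup of a group with a decomposition inherits a decomposition, whose value
is multiplied by the index. -/
theorem FreeProductDecomposition.exists_subgroup {C : GroupFamily.{u}}
    (hclosed : C.ClosedUnderFiniteIndex) {ρ : C.RealFunction}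
    (hρ : C.IsMultiplicativeInvariant ρ) {G : Type u} [Group G]
    (d : FreeProductDecomposition C G) (H : Subgroup G) (hH : H.FiniteIndex) :
    ∃ d' : FreeProductDecomposition C H, d'.value ρ = H.index * d.value ρ := by
  let P := Coprod (CoprodI d.factor) (FreeGroup (Fin d.r))
  let H' : Subgroup P := H.map d.equiv.toMonoidHom
  have hindex : H'.index = H.index := Subgroup.index_map_equiv H d.equiv
  have hH' : H'.FiniteIndex := ⟨by rw [hindex]; exact hH.index_ne_zero⟩
  -- In the action on cosets, `H'` is the stabilizer of the trivial coset, and `X` has the index as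
  -- its cardinality.
  let X := P ⧸ H'
  have hX : Finite X := inferInstanceAs (Finite (P ⧸ H'))
  let x₀ : X := ((1 : P) : P ⧸ H')
  obtain ⟨T⟩ := OrbitTransversal.nonempty (G := d.factor) (α := Fin d.r) (X := X)
  obtain ⟨R⟩ := T.nonempty_rootedSpanningTree x₀
  have e₁ : H ≃* H' := d.equiv.subgroupMap H
  have e₂ : H' ≃* MulAction.stabilizer P x₀ :=
    MulEquiv.subgroupCongr (MulAction.stabilizer_quotient H').symm
  have := Fintype.ofFinite T.Orbit
  let N := Nat.card T.Orbit
  let M := Nat.card {e : T.Edge // e ∉ Set.range R.parent}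
  let eN : Fin N ≃ T.Orbit := (Finite.equivFin T.Orbit).symm
  let eM : {e : T.Edge // e ∉ Set.range R.parent} ≃ Fin M := Finite.equivFin _
  obtain ⟨e₃⟩ := CoprodI.nonempty_mulEquiv_reindex
    (G := fun a : T.Orbit => T.orbitStabilizer a) eN
  have hmem : ∀ a : T.Orbit, C (T.orbitStabilizer a) := fun a =>
    hclosed _ (d.factor_mem a.1) _ (T.finiteIndex_orbitStabilizer a)
  let d' : FreeProductDecomposition C H :=
    { n := N
      r := M
      factor := fun i => T.orbitStabilizer (eN i)
      factor_mem := fun i => hmem (eN i)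
      equiv := (e₁.trans e₂).trans ((T.stabilizerEquiv R).trans
        (MulEquiv.coprodCongr e₃ (FreeGroup.freeGroupCongr eM))) }
  refine ⟨d', ?_⟩
  have hsum : ∑ i, ρ (d'.factor i) (d'.factor_mem i) =
      H.index * ∑ i, ρ (d.factor i) (d.factor_mem i) := by
    have h1 : ∑ i, ρ (d'.factor i) (d'.factor_mem i) =
        ∑ a : T.Orbit, ρ (T.orbitStabilizer a) (hmem a) :=
      eN.sum_comp fun a => ρ (T.orbitStabilizer a) (hmem a)
    rw [h1, ← hindex, Subgroup.index,
      ← T.sum_index_orbitStabilizer fun i => ρ (d.factor i) (d.factor_mem i)]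
    exact Finset.sum_congr rfl fun a _ => hρ.subgroup_eq _ (d.factor_mem a.1) _ _
      (T.finiteIndex_orbitStabilizer a)
  have hcard : (M : ℝ) + H.index + N = d.n * H.index + d.r * H.index + 1 := by
    have := T.card_edge_add R
    rw [Nat.card_fin, Nat.card_fin, show Nat.card X = H.index from hindex] at this
    exact_mod_cast this
  rw [value, value, hsum]
  change 1 - (M : ℝ) - N + _ = _
  -- `hcard` amounts to `1 - M - N = [G : H] * (1 - r - n)`.
  linear_combination -hcard

theorem proposition3p4 (C : GroupFamily.{u})
    (hends : ∀ (G : Type u) [Group G], C G → IsOneEnded G)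
    (hclosed : C.ClosedUnderFiniteIndex)
    (ρ : C.RealFunction) (hρ : C.IsMultiplicativeInvariant ρ) :
    (∀ (G : Type u) [Group G] (hG : C.freeProducts G) (d : FreeProductDecomposition C G),
      chiRho ρ G hG = 1 - (d.r : ℝ) - (d.n : ℝ) + ∑ i, ρ (d.factor i) (d.factor_mem i)) ∧
    C.freeProducts.ClosedUnderFiniteIndex ∧
    C.freeProducts.IsMultiplicativeInvariant (chiRho ρ) := by
  refine ⟨fun G _ hG d => FreeProductDecomposition.value_eq hends hρ (MulEquiv.refl G) _ d,
    fun G _ hG H hH => ?_, ⟨fun G H _ _ hG hH ⟨e⟩ =>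
      FreeProductDecomposition.value_eq hends hρ e _ _, fun G _ hG H hH hfin => ?_⟩⟩
  · obtain ⟨d⟩ := hG
    exact (d.exists_subgroup hclosed hρ H hH).nonempty
  · obtain ⟨d', hd'⟩ := (Classical.choice hG).exists_subgroup hclosed hρ H hfin
    rw [chiRho, chiRho, ← hd']
    exact FreeProductDecomposition.value_eq hends hρ (MulEquiv.refl H) _ _
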